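/- **Setting.** Let $\mathcal X$ be a measurable space, $\mathcal Y=\{0,1\}$, $\mathcal Z=\mathcal X\times\mathcal Y$, and let $\mathcal H\subseteq\mathcal Y^{\mathcal X}$ be a class of measurable functions. A sequence $(x_1,\dots,x_m)\in\mathcal X^m$ is shattered by $\mathcal H$ if for all $y\in\{0,1\}^m$ there is $h\in\mathcal H$ with $h(x_i)=y_i$ for all $i$. The class $\mathcal H$ is a VC class of dimension $d\in\{0,1,2,\dots\}$ if $d$ is the largest length of a shattered sequence. For $s=((x_1,y_1),\dots,(x_n,y_n))\in\mathcal Z^n$ put $\hat R_s(h)=\frac1n\sum_{i=1}^n\mathbf 1[h(x_i)\ne y_i]$; $s$ is realizable by $\mathcal H$ if some $h\in\mathcal H$ satisfies $h(x_i)=y_i$ for all $i$. A probability measure $\mathcal D$ on $\mathcal Z$ is realizable by $\mathcal H$ if $\mathcal D\{(x,y):h(x)\neq y\}=0$ for some $h\in\mathcal H$. A proper learning algorithm $\mathcal A$ for $\mathcal H$ is a possibly randomized map which, for every $n\ge1$, sends each $s\in\mathcal Z^n$ to a random element $\mathcal A(s)$ of $\mathcal H$ (with the $\sigma$-algebra on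 $\mathcal H$ generated by the evaluations $h\mapsto h(x)$). For a probability measure $\mathcal D$ on $\mathcal Z$, let $Z=(Z_{i,j})_{i\in\{0,1\},\,1\le j\le n}$ be i.i.d. with law $\mathcal D$, let $U$ be uniform on $\{0,1\}^n$ and independent of $Z$, and let $Z_U=(Z_{U_j,j})_{j=1}^n$. The conditional mutual information of $\mathcal A$ at sample size $n$ is $$\mathrm{CMI}_{\mathcal D}(\mathcal A)=I(\mathcal A(Z_U);U\mid Z)=\mathbb E_Z\Big[\mathrm{KL}\big(P_{(\mathcal A(Z_U),U)\mid Z}\,\big\|\,P_{\mathcal A(Z_U)\mid Z}\otimes P_{U\mid Z}\big)\Big].$$ **Theorem.** The following statement is false: > There exist a function $f:\mathbb N\to\mathbb R$ and a constant $c\ge0$ such that, for every nonnegative integer $d$, every measurable space $\mathcal X$ and every VC class $\mathcal H\subseteq\{0,1\}^{\mathcal X}$ of measurable functions of dimension $d$, there exists a proper learning algorithm $\mathcal A$ for $\mathcal H$ such that, for every integer $n\ge\max(d,1)$, > (i) $\mathrm{CMI}_{\mathcal D}(\mathcal A)\le f(d)$ for all probability measures $\mathcal D$ on $\mathcal Z$,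 and > (ii) $\mathbb E\,\hat R_s(\mathcal A(s))\le c\,d/n$ for every $s\in\mathcal Z^n$ realizable by $\mathcal H$, where the expectation is over the randomness in $\mathcal A$ only. It remains false if in (i) only the probability measures $\mathcal D$ that are realizable by $\mathcal H$ are considered. (In particular, the statement fails for linear $f$, which answers negatively the open problem of Steinke and Zakynthinou whether every VC class has a proper learner with CMI of order $O(d)$ and, on realizable samples, expected empirical risk $O(d/n)$.) -/

import Mathlib

open MeasureTheory ProbabilityTheory

universe u

namespace ProperCMI

noncomputable section

/-- A sequence `x` of points is shattered by the class `H` if all label patterns are realized. -/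
def Shatters {X : Type u} (H : Set (X → Bool)) {m : ℕ} (x : Fin m → X) : Prop :=
  ∀ y : Fin m → Bool, ∃ h ∈ H, ∀ i, h (x i) = y i

/-- The VC dimension of `H` is the natural number `d`: the largest length of a shattered
sequence. (An infinite VC dimension, or an empty class, satisfies this for no `d`.) -/
def HasVCDim {X : Type u} (H : Set (X → Bool)) (d : ℕ) : Prop :=
  IsGreatest {m : ℕ | ∃ x : Fin m → X, Shatters H x} d

/-- The empirical classification risk of `h` on the sample `s`. -/
def empRisk {X : Type u} {n : ℕ} (s : Fin n → X × Bool) (h : X → Bool) : ℝ :=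
  (n : ℝ)⁻¹ * ∑ i, if h (s i).1 ≠ (s i).2 then 1 else 0

/-- The sample `s` is realizable by `H`. -/
def RealizableSample {X : Type u} (H : Set (X → Bool)) {n : ℕ} (s : Fin n → X × Bool) : Prop :=
  ∃ h ∈ H, ∀ i, h (s i).1 = (s i).2

/-- The classification risk of `h` under the distribution `D`. -/
def risk {X : Type u} [MeasurableSpace X] (D : Measure (X × Bool)) (h : X → Bool) : ENNReal :=
  D {z | h z.1 ≠ z.2}

/-- The distribution `D` is realizable by `H`. -/
def RealizableDist {X : Type u} [MeasurableSpace X] (H : Set (X → Bool))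
    (D : Measure (X × Bool)) : Prop :=
  ∃ h ∈ H, risk D h = 0

/-- A randomized proper learning algorithm for `H`: for each sample size `n`, each sample is sent
to the law of the output hypothesis, a probability measure on `H`. Here `H` carries the
`σ`-algebra generated by the evaluations `h ↦ h x`. Measurability in the sample is not demanded,
so every Markov kernel is included. -/
abbrev ProperLearner {X : Type u} (H : Set (X → Bool)) : Type u :=
  (n : ℕ) → (Fin n → X × Bool) → ProbabilityMeasure H

/-- The expected empirical risk of the learner `A` on the fixed sample `s`; the expectation is
over the internal randomness of `A` only. -/
def expectedEmpRisk {X : Type u} {H : Set (X → Bool)} (A : ProperLearner H) {n : ℕ}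
    (s : Fin n → X × Bool) : ℝ :=
  ∫ h : H, empRisk s (h : X → Bool) ∂(A n s : Measure H)

/-- Mutual information (in nats) of a pair with joint law `μ`: the Kullback–Leibler divergence of
`μ` with respect to the product of its marginals. -/
def mutualInfo {α β : Type*} [MeasurableSpace α] [MeasurableSpace β] (μ : Measure (α × β)) :
    ENNReal :=
  InformationTheory.klDiv μ (μ.fst.prod μ.snd)

/-- The law of `n` independent fair bits `U`. -/
def fairBits (n : ℕ) : Measure (Fin n → Bool) :=
  Measure.pi fun _ => (PMF.uniformOfFintype Bool).toMeasure

/-- The training sample selected by `u` from the supersample `z`. -/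
def selectSample {Z : Type*} {n : ℕ} (z : Bool × Fin n → Z) (u : Fin n → Bool) : Fin n → Z :=
  fun j => z (u j, j)

/-- For a fixed supersample `z`, the conditional law of the output of `A` given the bits `u`. -/
def outputKernel {X : Type u} {H : Set (X → Bool)} (A : ProperLearner H) {n : ℕ}
    (z : Bool × Fin n → X × Bool) : Kernel (Fin n → Bool) H :=
  Kernel.ofFunOfCountable fun u => (A n (selectSample z u) : Measure H)

/-- The conditional law of (output of `A`, bits `U`) given that the supersample equals `z`: the
bits are fair and independent of the supersample, and the output has law `A n z_U`. -/
def condJointLaw {X : Type u} {H : Set (X → Bool)} (A : ProperLearner H) {n : ℕ}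
    (z : Bool × Fin n → X × Bool) : Measure (H × (Fin n → Bool)) :=
  (fairBits n ⊗ₘ outputKernel A z).map Prod.swap

/-- The conditional mutual information `I(A(Z_U); U | Z)` at sample size `n`: the expectation of
the disintegrated mutual information over a supersample `Z` of `2n` i.i.d. draws from `D`. -/
def cmi {X : Type u} [MeasurableSpace X] {H : Set (X → Bool)} (A : ProperLearner H) (n : ℕ)
    (D : Measure (X × Bool)) : ENNReal :=
  ∫⁻ z : Bool × Fin n → X × Bool, mutualInfo (condJointLaw A z) ∂(Measure.pi fun _ => D)

end

end ProperCMI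

open ProperCMI

/-!
The counterexample is the class of indicators of the single points of a finite set with `N` points,
which has VC dimension `1`.

Fix a proper learner and a supersample `z`, and let `h` be the output. If `h` were independent of
the bits `u`, then `(3/2) ^ (errors of h on the ghost sample) * (1/2) ^ (errors of h on the selected
sample)` would have mean at most `1` (`lintegral_exp_errorCount_le_one`). The Donsker–Varadhan bound
(`lintegral_le_klDiv_add_lintegral`) turns this into
`log (3/2) * E (ghost errors) ≤ I(A(z_U); U) + log 2 * E (training errors)`. After averaging over
`z`, the ghost sample is a fresh sample independent of the output, so that
`log (3/2) * n * E (risk) ≤ CMI + log 2 * n * E (empirical risk)` (`mul_lintegral_risk_le_cmi_add`).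
A learner with the two properties in question therefore has `n * E (risk)` bounded, uniformly in
`n`, in `N` and in the realizable distribution.

On the other hand, let the points be uniform on the complement of one point `i`, with all labels
`0`. This law is realizable, by the indicator of `i` only, and every other member of the class has
risk `1 / (N - 1)`. With `n = K (N - 1)`, the law of the sample has density at most
`(1 + 1 / (N - 1)) ^ n ≤ exp K` with respect to the uniform law on all samples, which does not
depend on `i`; summed over the `N` values of `i`, the probabilities of the output being the
indicator of `i` are thus at most `exp K` (`sum_lintegral_pointHyp_le`). If `N ≥ 2 * exp K`, one of
them is at most `1/2`, and for this `i` one gets `n * E (risk) ≥ K / 2`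
(`exists_le_lintegral_risk_awayLaw`). Letting `K` grow contradicts the first bound.
-/

namespace ProperCMI

open scoped ENNReal

/-! ### A variational bound for the Kullback–Leibler divergence -/

/-- The Fenchel–Young inequality for `x ↦ x log x - x + 1`, whose convex conjugate is
`t ↦ exp t - 1`. -/
lemma mul_add_one_le_klFun_add_exp {x : ℝ} (hx : 0 ≤ x) (t : ℝ) :
    x * t + 1 ≤ InformationTheory.klFun x + Real.exp t := by
  rw [InformationTheory.klFun_apply]
  rcases hx.eq_or_lt with rfl | hx
  · simpa using (Real.exp_pos t).le
  · have h := Real.add_one_le_exp (t - Real.log x)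
    have h2 : Real.exp (t - Real.log x) * x = Real.exp t := by
      rw [Real.exp_sub, Real.exp_log hx, div_mul_cancel₀ _ hx.ne']
    nlinarith [mul_le_mul_of_nonneg_right h hx.le]

/-- The Donsker–Varadhan bound `∫ (a - b) ∂μ ≤ klDiv μ ν` for `∫ exp (a - b) ∂ν ≤ 1`. The two
nonnegative parts are kept on different sides, so that no integrability is needed. -/
lemma lintegral_le_klDiv_add_lintegral {Ω : Type*} [MeasurableSpace Ω] (μ ν : Measure Ω)
    [IsFiniteMeasure μ] [IsProbabilityMeasure ν] {a b : Ω → ℝ} (ha : Measurable a)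
    (hb : Measurable b) (ha0 : ∀ ω, 0 ≤ a ω) (hb0 : ∀ ω, 0 ≤ b ω)
    (hexp : ∫⁻ ω, ENNReal.ofReal (Real.exp (a ω - b ω)) ∂ν ≤ 1) :
    ∫⁻ ω, ENNReal.ofReal (a ω) ∂μ
      ≤ InformationTheory.klDiv μ ν + ∫⁻ ω, ENNReal.ofReal (b ω) ∂μ := by
  by_cases hac : μ ≪ ν
  swap; · simp [InformationTheory.klDiv_of_not_ac hac]
  rw [InformationTheory.klDiv_eq_lintegral_klFun_of_ac hac,
    ← lintegral_rnDeriv_mul hac ha.ennreal_ofReal.aemeasurable,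
    ← lintegral_rnDeriv_mul hac hb.ennreal_ofReal.aemeasurable]
  refine (ENNReal.add_le_add_iff_right ENNReal.one_ne_top).1 ?_
  calc ∫⁻ ω, μ.rnDeriv ν ω * ENNReal.ofReal (a ω) ∂ν + 1
      = ∫⁻ ω, (μ.rnDeriv ν ω * ENNReal.ofReal (a ω) + 1) ∂ν := by
        rw [lintegral_add_right _ measurable_const]; simp
    _ ≤ ∫⁻ ω, (ENNReal.ofReal (InformationTheory.klFun (μ.rnDeriv ν ω).toReal)
          + μ.rnDeriv ν ω * ENNReal.ofReal (b ω)
          + ENNReal.ofReal (Real.exp (a ω - b ω))) ∂ν := by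
        refine lintegral_mono_ae ?_
        filter_upwards [Measure.rnDeriv_lt_top μ ν] with ω hω
        obtain ⟨x, hx0, hx⟩ : ∃ x : ℝ, 0 ≤ x ∧ μ.rnDeriv ν ω = ENNReal.ofReal x :=
          ⟨_, ENNReal.toReal_nonneg, (ENNReal.ofReal_toReal hω.ne).symm⟩
        rw [hx, ENNReal.toReal_ofReal hx0, ← ENNReal.ofReal_mul hx0, ← ENNReal.ofReal_mul hx0,
          ← ENNReal.ofReal_one, ← ENNReal.ofReal_add (mul_nonneg hx0 (ha0 ω)) zero_le_one,
          ← ENNReal.ofReal_add (InformationTheory.klFun_nonneg hx0) (mul_nonneg hx0 (hb0 ω)),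
          ← ENNReal.ofReal_add (add_nonneg (InformationTheory.klFun_nonneg hx0)
            (mul_nonneg hx0 (hb0 ω))) (Real.exp_pos _).le]
        refine ENNReal.ofReal_le_ofReal ?_
        linarith [mul_add_one_le_klFun_add_exp hx0 (a ω - b ω)]
    _ = ∫⁻ ω, ENNReal.ofReal (InformationTheory.klFun (μ.rnDeriv ν ω).toReal) ∂ν
          + ∫⁻ ω, μ.rnDeriv ν ω * ENNReal.ofReal (b ω) ∂ν
          + ∫⁻ ω, ENNReal.ofReal (Real.exp (a ω - b ω)) ∂ν := by
        rw [lintegral_add_right _ (by fun_prop), lintegral_add_right _ (by fun_prop)]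
    _ ≤ _ := by gcongr

/-! ### Errors on the selected sample and on the ghost sample -/

/-- The number of errors of the hypothesis `h` on the sample `s`. -/
def errorCount {X : Type*} {n : ℕ} (s : Fin n → X × Bool) (h : X → Bool) : ℕ :=
  ∑ i, if h (s i).1 ≠ (s i).2 then 1 else 0

lemma measurable_errorCount {X : Type*} {H : Set (X → Bool)} {n : ℕ} (s : Fin n → X × Bool) :
    Measurable fun h : H => errorCount s (h : X → Bool) := by
  unfold errorCount
  refine Finset.measurable_sum _ fun i _ => ?_
  have : Measurable fun h : H => (h : X → Bool) (s i).1 :=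
    (measurable_pi_apply _).comp measurable_subtype_coe
  exact (measurable_of_countable fun b : Bool => if b ≠ (s i).2 then 1 else 0).comp this

lemma errorCount_eq_mul_empRisk {X : Type u} {n : ℕ} (hn : n ≠ 0) (s : Fin n → X × Bool)
    (h : X → Bool) : (errorCount s h : ℝ) = n * empRisk s h := by
  simp [errorCount, empRisk, hn]

/-- The points of the supersample that are not selected by `u`. -/
def ghostSample {Z : Type*} {n : ℕ} (z : Bool × Fin n → Z) (u : Fin n → Bool) : Fin n → Z :=
  selectSample z fun j => !u j

instance (n : ℕ) : IsProbabilityMeasure (fairBits n) := by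
  unfold fairBits; infer_instance

lemma lintegral_fairBits_prod {n : ℕ} (f : Fin n → Bool → ℝ≥0∞) :
    ∫⁻ u, ∏ k, f k (u k) ∂(fairBits n) = ∏ k, (f k true + f k false) / 2 := by
  have h2 : ∀ k, (f k true + f k false) / 2 = ∑ b : Bool, f k b * 2⁻¹ := fun k => by
    simp [div_eq_mul_inv, add_mul]
  simp_rw [h2, Finset.prod_univ_sum, lintegral_fintype, fairBits, Measure.pi_singleton,
    Fintype.piFinset_univ, Finset.prod_mul_distrib]
  refine Finset.sum_congr rfl fun u _ => ?_
  congr 1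
  refine Finset.prod_congr rfl fun k _ => ?_
  rw [PMF.toMeasure_apply_singleton _ _ (measurableSet_singleton _)]
  simp

/-- For a hypothesis that is fixed before the bits are drawn, each position contributes a factor
whose mean is at most `1`: it is `(3/2 + 1/2) / 2` if exactly one of the two candidates is an error,
`3/4` if both are, and `1` if none is. -/
lemma lintegral_exp_errorCount_le_one {X : Type*} {n : ℕ} (z : Bool × Fin n → X × Bool)
    (h : X → Bool) :
    ∫⁻ u, ENNReal.ofReal (Real.exp (Real.log (3 / 2) * errorCount (ghostSample z u) h
      - Real.log 2 * errorCount (selectSample z u) h)) ∂(fairBits n) ≤ 1 := by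
  set e : Fin n → Bool → Prop := fun k b => h (z (b, k)).1 ≠ (z (b, k)).2 with he
  set w : Fin n → Bool → ℝ := fun k b =>
    (if e k (!b) then 3 / 2 else 1) * (if e k b then 1 / 2 else 1) with hw
  have hexp : ∀ u : Fin n → Bool,
      ENNReal.ofReal (Real.exp (Real.log (3 / 2) * errorCount (ghostSample z u) h
        - Real.log 2 * errorCount (selectSample z u) h))
      = ∏ k, ENNReal.ofReal (w k (u k)) := by
    intro u
    rw [← ENNReal.ofReal_prod_of_nonneg (fun k _ => by simp only [hw]; positivity)]
    congr 1
    simp only [errorCount, ghostSample, selectSample, Nat.cast_sum, Finset.mul_sum,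
      ← Finset.sum_sub_distrib, Real.exp_sum]
    refine Finset.prod_congr rfl fun k _ => ?_
    simp only [hw, he]
    rw [Real.exp_sub]
    by_cases hg : h (z (!u k, k)).1 = (z (!u k, k)).2 <;>
      by_cases hs : h (z (u k, k)).1 = (z (u k, k)).2 <;>
      (simp [hg, hs, Real.exp_log]; try norm_num)
  simp_rw [hexp, lintegral_fairBits_prod fun k b => ENNReal.ofReal (w k b)]
  refine Finset.prod_le_one' fun k _ => ?_
  have h1 : w k true + w k false ≤ 2 := by
    simp only [hw, Bool.not_true, Bool.not_false]
    split_ifs <;> norm_num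
  rw [← ENNReal.ofReal_add (by simp only [hw]; positivity) (by simp only [hw]; positivity)]
  refine ENNReal.div_le_of_le_mul ?_
  rw [one_mul]
  exact (ENNReal.ofReal_le_ofReal h1).trans (by simp)

instance {X : Type u} {H : Set (X → Bool)} (A : ProperLearner H) {n : ℕ}
    (z : Bool × Fin n → X × Bool) : IsMarkovKernel (outputKernel A z) :=
  ⟨fun u => by change IsProbabilityMeasure (A n (selectSample z u) : Measure H); infer_instance⟩

/-- For a fixed supersample, the mutual information of the output and the bits controls the errors
on the ghost sample by the errors on the selected sample. -/
lemma lintegral_errorCount_ghostSample_le {X : Type u} {H : Set (X → Bool)} (A : ProperLearner H)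
    {n : ℕ} (z : Bool × Fin n → X × Bool) :
    ∫⁻ u, ∫⁻ h, ENNReal.ofReal (Real.log (3 / 2)) * errorCount (ghostSample z u) (h : X → Bool)
        ∂(A n (selectSample z u) : Measure H) ∂(fairBits n)
      ≤ mutualInfo (condJointLaw A z)
        + ∫⁻ u, ∫⁻ h, ENNReal.ofReal (Real.log 2) * errorCount (selectSample z u) (h : X → Bool)
          ∂(A n (selectSample z u) : Measure H) ∂(fairBits n) := by
  have hmeas : ∀ (r : ℝ) (S : (Fin n → Bool) → Fin n → X × Bool),
      Measurable fun p : H × (Fin n → Bool) => r * (errorCount (S p.2) (p.1 : X → Bool) : ℝ) :=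
    fun r S => measurable_from_prod_countable_left fun u =>
      ((measurable_of_countable fun m : ℕ => r * (m : ℝ)).comp (measurable_errorCount (S u)))
  have hint : ∀ (r : ℝ), 0 ≤ r → ∀ S : (Fin n → Bool) → Fin n → X × Bool,
      ∫⁻ p, ENNReal.ofReal (r * (errorCount (S p.2) (p.1 : X → Bool) : ℝ)) ∂(condJointLaw A z)
      = ∫⁻ u, ∫⁻ h, ENNReal.ofReal r * errorCount (S u) (h : X → Bool)
        ∂(A n (selectSample z u) : Measure H) ∂(fairBits n) := by
    intro r hr S
    have hsw : Measurable fun p : (Fin n → Bool) × H =>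
        ENNReal.ofReal (r * (errorCount (S p.1) (p.2 : X → Bool) : ℝ)) :=
      measurable_from_prod_countable_right fun u =>
        (measurable_of_countable fun m : ℕ => ENNReal.ofReal (r * (m : ℝ))).comp
          (measurable_errorCount (S u))
    rw [condJointLaw, lintegral_map (hmeas r S).ennreal_ofReal measurable_swap]
    refine (Measure.lintegral_compProd hsw).trans (lintegral_congr fun u => ?_)
    simp only [ENNReal.ofReal_mul hr, ENNReal.ofReal_natCast]
    rfl
  have : IsProbabilityMeasure (condJointLaw A z) :=
    Measure.isProbabilityMeasure_map measurable_swap.aemeasurable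
  have hsnd : (condJointLaw A z).snd = fairBits n := by
    rw [condJointLaw, Measure.snd_map_swap, Measure.fst_compProd]
  rw [← hint _ (Real.log_nonneg (by norm_num)) (ghostSample z),
    ← hint _ (Real.log_nonneg (by norm_num)) (selectSample z)]
  refine lintegral_le_klDiv_add_lintegral _ _ (hmeas _ _) (hmeas _ _)
    (fun p => mul_nonneg (Real.log_nonneg (by norm_num)) (Nat.cast_nonneg _))
    (fun p => mul_nonneg (Real.log_nonneg (by norm_num)) (Nat.cast_nonneg _)) ?_
  rw [hsnd, lintegral_prod]
  · calc _ ≤ ∫⁻ _ : H, 1 ∂(condJointLaw A z).fst :=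
          lintegral_mono fun h => lintegral_exp_errorCount_le_one z h
      _ = 1 := by simp
  · exact (Real.measurable_exp.comp
      ((hmeas _ (ghostSample z)).sub (hmeas _ (selectSample z)))).ennreal_ofReal.aemeasurable

/-! ### Bounded conditional mutual information forces small risk -/

/-- The positions of the supersample, sorted into those selected by `u` and the others. -/
def selectEquiv {n : ℕ} (u : Fin n → Bool) : Fin n ⊕ Fin n ≃ Bool × Fin n where
  toFun := Sum.elim (fun k => (u k, k)) (fun k => (!u k, k))
  invFun p := if p.1 = u p.2 then .inl p.2 else .inr p.2
  left_inv := by rintro (k | k) <;> simp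
  right_inv := by
    rintro ⟨b, k⟩
    cases b <;> cases hu : u k <;> simp [hu]

/-- Whatever the bits are, the selected sample and the ghost sample are independent i.i.d.
samples. -/
lemma measurePreserving_selectSample_ghostSample {Z : Type*} [MeasurableSpace Z] (D : Measure Z)
    [IsProbabilityMeasure D] {n : ℕ} (u : Fin n → Bool) :
    MeasurePreserving (fun z : Bool × Fin n → Z => (selectSample z u, ghostSample z u))
      (Measure.pi fun _ => D) ((Measure.pi fun _ => D).prod (Measure.pi fun _ => D)) :=
  (measurePreserving_sumPiEquivProdPi (X := fun _ : Fin n ⊕ Fin n => Z) fun _ => D).comp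
    (measurePreserving_piCongrLeft (α := fun _ => Z) (fun _ => D) (selectEquiv u)).symm

lemma lintegral_errorCount {X : Type u} [MeasurableSpace X] [Countable X]
    [MeasurableSingletonClass X] (D : Measure (X × Bool)) [IsProbabilityMeasure D] (n : ℕ)
    (h : X → Bool) :
    ∫⁻ s : Fin n → X × Bool, errorCount s h ∂(Measure.pi fun _ => D) = n * risk D h := by
  simp only [errorCount, Nat.cast_sum]
  rw [lintegral_finsetSum _ fun k _ => measurable_of_countable _]
  have hk : ∀ k : Fin n, ∫⁻ s : Fin n → X × Bool,
      ((if h (s k).1 ≠ (s k).2 then 1 else 0 : ℕ) : ℝ≥0∞) ∂(Measure.pi fun _ => D)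
      = risk D h := by
    intro k
    have := (measurePreserving_eval (fun _ : Fin n => D) k).lintegral_comp
      (f := fun p => ((if h p.1 ≠ p.2 then 1 else 0 : ℕ) : ℝ≥0∞)) (measurable_of_countable _)
    refine this.trans ?_
    rw [risk, ← lintegral_indicator_one (Set.to_countable _).measurableSet]
    refine lintegral_congr fun p => ?_
    by_cases hp : h p.1 = p.2 <;> simp [hp]
  rw [Finset.sum_congr rfl fun k _ => hk k]
  simp

/-- A risk bound of the fast-rate form: up to constants, the expected number of errors of the output
on a fresh sample is at most the conditional mutual information plus the expected number of errors
on the training sample. -/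
lemma mul_lintegral_risk_le_cmi_add {X : Type u} [MeasurableSpace X] [Countable X]
    [MeasurableSingletonClass X] {H : Set (X → Bool)} (A : ProperLearner H) (n : ℕ)
    (D : Measure (X × Bool)) [IsProbabilityMeasure D] :
    ENNReal.ofReal (Real.log (3 / 2)) *
        (n * ∫⁻ s, ∫⁻ h, risk D h ∂(A n s : Measure H) ∂(Measure.pi fun _ => D))
      ≤ cmi A n D + ENNReal.ofReal (Real.log 2) *
        ∫⁻ s, ∫⁻ h, errorCount s (h : X → Bool) ∂(A n s : Measure H)
          ∂(Measure.pi fun _ => D) := by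
  have hH : ∀ s : Fin n → X × Bool, Measurable fun h : H => (errorCount s (h : X → Bool) : ℝ≥0∞) :=
    fun s => (measurable_of_countable fun m : ℕ => (m : ℝ≥0∞)).comp (measurable_errorCount s)
  -- The expected errors of `A` on `t`, trained on `s`.
  set Φ : (Fin n → X × Bool) × (Fin n → X × Bool) → ℝ≥0∞ :=
    fun p => ∫⁻ h, errorCount p.2 (h : X → Bool) ∂(A n p.1 : Measure H) with hΦ
  have hswap : ∀ (c : ℝ≥0∞) (T : (Fin n → X × Bool) × (Fin n → X × Bool) → Fin n → X × Bool),
      ∫⁻ z : Bool × Fin n → X × Bool, ∫⁻ u, ∫⁻ h,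
          c * errorCount (T (selectSample z u, ghostSample z u)) (h : X → Bool)
          ∂(A n (selectSample z u) : Measure H) ∂(fairBits n) ∂(Measure.pi fun _ => D)
        = c * ∫⁻ s, ∫⁻ t, Φ (s, T (s, t)) ∂(Measure.pi fun _ => D) ∂(Measure.pi fun _ => D) := by
    intro c T
    rw [lintegral_lintegral_swap (measurable_of_countable _).aemeasurable]
    have : ∀ u : Fin n → Bool, ∫⁻ z : Bool × Fin n → X × Bool, ∫⁻ h,
          c * errorCount (T (selectSample z u, ghostSample z u)) (h : X → Bool)
          ∂(A n (selectSample z u) : Measure H) ∂(Measure.pi fun _ => D)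
        = c * ∫⁻ s, ∫⁻ t, Φ (s, T (s, t)) ∂(Measure.pi fun _ => D)
          ∂(Measure.pi fun _ => D) := by
      intro u
      simp_rw [lintegral_const_mul _ (hH _)]
      rw [lintegral_const_mul _ (measurable_of_countable _),
        ← lintegral_prod (fun p => Φ (p.1, T p)) (measurable_of_countable _).aemeasurable,
        ← (measurePreserving_selectSample_ghostSample D u).lintegral_comp
          (measurable_of_countable _)]
    simp [this]
  have hghost : ∀ s : Fin n → X × Bool, ∫⁻ t, Φ (s, t) ∂(Measure.pi fun _ => D)
      = n * ∫⁻ h, risk D h ∂(A n s : Measure H) := by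
    intro s
    have hm : Measurable fun p : (Fin n → X × Bool) × H =>
        (errorCount p.1 (p.2 : X → Bool) : ℝ≥0∞) := measurable_from_prod_countable_right hH
    simp only [hΦ]
    rw [lintegral_lintegral_swap hm.aemeasurable]
    simp_rw [lintegral_errorCount]
    rw [lintegral_const_mul' _ _ (ENNReal.natCast_ne_top n)]
  have hz := lintegral_mono (μ := Measure.pi fun _ : Bool × Fin n => D)
    fun z => lintegral_errorCount_ghostSample_le A z
  rw [lintegral_add_left (measurable_of_countable _)] at hz
  have h1 := hswap (ENNReal.ofReal (Real.log (3 / 2))) Prod.snd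
  have h2 := hswap (ENNReal.ofReal (Real.log 2)) Prod.fst
  simp only at h1 h2
  rw [h1, h2] at hz
  simp_rw [hghost] at hz
  rw [lintegral_const_mul _ (measurable_of_countable _)] at hz
  simpa [hΦ, cmi] using hz

/-- Under a realizable distribution, almost every sample is realizable. -/
lemma RealizableDist.ae_realizableSample {X : Type u} [MeasurableSpace X] {H : Set (X → Bool)}
    {D : Measure (X × Bool)} [SigmaFinite D] (hD : RealizableDist H D) (n : ℕ) :
    ∀ᵐ s : Fin n → X × Bool ∂(Measure.pi fun _ => D), RealizableSample H s := by
  obtain ⟨h, hh, hr⟩ := hD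
  have h0 : ∀ᵐ p ∂D, h p.1 = p.2 := by simpa [ae_iff, risk] using hr
  have : ∀ᵐ s : Fin n → X × Bool ∂(Measure.pi fun _ => D), ∀ k, h (s k).1 = (s k).2 :=
    Filter.eventually_all.2 fun k =>
      (Measure.tendsto_eval_ae_ae (μ := fun _ : Fin n => D) (i := k)).eventually h0
  filter_upwards [this] with s hs using ⟨h, hh, hs⟩

lemma lintegral_errorCount_eq_ofReal {X : Type u} {H : Set (X → Bool)} (A : ProperLearner H)
    {n : ℕ} (hn : n ≠ 0) (s : Fin n → X × Bool) :
    ∫⁻ h, errorCount s (h : X → Bool) ∂(A n s : Measure H)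
      = ENNReal.ofReal (n * expectedEmpRisk A s) := by
  have hle : ∀ h : X → Bool, errorCount s h ≤ n := fun h => by
    calc errorCount s h ≤ ∑ _ : Fin n, 1 := Finset.sum_le_sum fun i _ => by split_ifs <;> simp
      _ = n := by simp
  have hm : Measurable fun h : H => (errorCount s (h : X → Bool) : ℝ) :=
    (measurable_of_countable fun m : ℕ => (m : ℝ)).comp (measurable_errorCount s)
  have hi : Integrable (fun h : H => (errorCount s (h : X → Bool) : ℝ)) (A n s : Measure H) :=
    Integrable.of_bound hm.aestronglyMeasurable n
      (ae_of_all _ fun h => by simpa using hle h)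
  rw [expectedEmpRisk, ← integral_const_mul]
  simp_rw [← errorCount_eq_mul_empRisk hn]
  rw [ofReal_integral_eq_lintegral_ofReal hi (ae_of_all _ fun h => Nat.cast_nonneg _)]
  simp

/-! ### The class of indicators of points -/

section PointClass

/-- The indicators of the single points of `X`. -/
def pointClass (X : Type u) [DecidableEq X] : Set (X → Bool) :=
  Set.range fun i x : X => decide (x = i)

/-- The indicator of `i`, as an element of the class. -/
def pointHyp {X : Type u} [DecidableEq X] (i : X) : pointClass X :=
  ⟨fun x => decide (x = i), i, rfl⟩

variable {X : Type u} [DecidableEq X]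

lemma pointHyp_apply (i x : X) : (pointHyp i : X → Bool) x = decide (x = i) := rfl

lemma pointHyp_surjective : Function.Surjective (pointHyp : X → pointClass X) := by
  rintro ⟨_, i, rfl⟩; exact ⟨i, rfl⟩

lemma pointHyp_injective : Function.Injective (pointHyp : X → pointClass X) := by
  intro i j h
  have : (pointHyp i : X → Bool) i = (pointHyp j : X → Bool) i := by rw [h]
  simpa [pointHyp_apply] using this

lemma hasVCDim_pointClass [Nontrivial X] : HasVCDim (pointClass X) 1 := by
  constructor
  · obtain ⟨x₀, x₁, hne⟩ := exists_pair_ne X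
    refine ⟨fun _ => x₀, fun y => ?_⟩
    cases hy : y 0
    · exact ⟨_, (pointHyp x₁).2, fun i => by
        rw [Subsingleton.elim i 0, hy, pointHyp_apply]; simpa using hne⟩
    · exact ⟨_, (pointHyp x₀).2, fun i => by
        rw [Subsingleton.elim i 0, hy, pointHyp_apply]; simp⟩
  · rintro m ⟨x, hx⟩
    by_contra! hm
    -- On a shattered pair, one indicator is `1` at both points, which therefore coincide; then no
    -- indicator tells them apart.
    obtain ⟨_, ⟨i, rfl⟩, hi⟩ := hx fun _ => true
    obtain ⟨h, -, hh⟩ := hx fun k => decide (k = ⟨0, by omega⟩)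
    have h0 := hh ⟨0, by omega⟩
    have h1 := hh ⟨1, hm⟩
    have e0 : x ⟨0, by omega⟩ = i := by simpa using hi ⟨0, by omega⟩
    have e1 : x ⟨1, hm⟩ = i := by simpa using hi ⟨1, hm⟩
    rw [e0] at h0
    rw [e1, h0] at h1
    simp at h1

variable [Fintype X] [Nontrivial X] [MeasurableSpace X] [MeasurableSingletonClass X]

/-- The uniform law on the points other than `i`, all labelled `0`. -/
noncomputable def awayLaw (i : X) : Measure (X × Bool) :=
  (PMF.uniformOfFinset ((Finset.univ.erase i) ×ˢ {false}) (by
    obtain ⟨j, hj⟩ := exists_ne i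
    exact ⟨(j, false), by simpa using hj⟩)).toMeasure

instance (i : X) : IsProbabilityMeasure (awayLaw i) := by
  unfold awayLaw; infer_instance

lemma awayLaw_singleton (i : X) (p : X × Bool) :
    awayLaw i {p} = if p.1 ≠ i ∧ p.2 = false then ((Fintype.card X - 1 : ℕ) : ℝ≥0∞)⁻¹ else 0 := by
  rw [awayLaw, PMF.toMeasure_apply_singleton _ _ (measurableSet_singleton _),
    PMF.uniformOfFinset_apply]
  obtain ⟨x, b⟩ := p
  cases b <;> simp [Finset.card_erase_of_mem]

lemma realizableDist_awayLaw (i : X) : RealizableDist (pointClass X) (awayLaw i) := by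
  refine ⟨_, (pointHyp i).2, ?_⟩
  rw [risk, ← Set.biUnion_of_singleton {z : X × Bool | (pointHyp i : X → Bool) z.1 ≠ z.2},
    measure_biUnion_null_iff (Set.to_countable _)]
  rintro ⟨x, b⟩ hp
  rw [awayLaw_singleton, if_neg]
  rintro ⟨h1, h2⟩
  simp_all [pointHyp_apply]

/-- Every member of the class but the indicator of `i` errs at a point of mass `1 / (card X - 1)`. -/
lemma inv_le_risk_awayLaw_add (i : X) (h : pointClass X) :
    ((Fintype.card X - 1 : ℕ) : ℝ≥0∞)⁻¹
      ≤ risk (awayLaw i) h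
        + ((Fintype.card X - 1 : ℕ) : ℝ≥0∞)⁻¹ * ({pointHyp i} : Set (pointClass X)).indicator 1 h := by
  obtain ⟨j, rfl⟩ := pointHyp_surjective h
  by_cases hij : j = i
  · simp [hij]
  · refine le_add_right ?_
    calc ((Fintype.card X - 1 : ℕ) : ℝ≥0∞)⁻¹ = awayLaw i {(j, false)} := by
          simp [awayLaw_singleton, hij]
      _ ≤ _ := measure_mono (by simp [pointHyp_apply])

/-- The learner cannot guess the missing point: a sample from `awayLaw i` is, up to the density
factor `(card X / (card X - 1)) ^ n`, a sample from the uniform law, which carries no information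
about `i`. -/
lemma sum_lintegral_pointHyp_le (A : ProperLearner (pointClass X)) (n : ℕ) :
    ∑ i : X, ∫⁻ s, (A n s : Measure (pointClass X)) {pointHyp i}
        ∂(Measure.pi fun _ : Fin n => awayLaw i)
      ≤ (Fintype.card X * ((Fintype.card X - 1 : ℕ) : ℝ≥0∞)⁻¹) ^ n := by
  set m : ℝ≥0∞ := ((Fintype.card X - 1 : ℕ) : ℝ≥0∞)⁻¹ with hm
  set φ : X × Bool → ℝ≥0∞ := fun p => if p.2 = false then m else 0 with hφ
  have hone : ∀ s : Fin n → X × Bool,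
      ∑ i : X, (A n s : Measure (pointClass X)) {pointHyp i} ≤ 1 := by
    intro s
    refine (sum_measure_le_measure_univ
      (fun i _ => (measurableSet_singleton (pointHyp i)).nullMeasurableSet) ?_).trans_eq
      measure_univ
    intro i _ j _ hij
    exact (Set.disjoint_singleton.2 (pointHyp_injective.ne hij)).aedisjoint
  calc ∑ i : X, ∫⁻ s, (A n s : Measure (pointClass X)) {pointHyp i}
        ∂(Measure.pi fun _ : Fin n => awayLaw i)
      ≤ ∑ i : X, ∑ s : Fin n → X × Bool,
          (A n s : Measure (pointClass X)) {pointHyp i} * ∏ k, φ (s k) := by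
        refine Finset.sum_le_sum fun i _ => ?_
        rw [lintegral_fintype]
        refine Finset.sum_le_sum fun s _ => ?_
        rw [Measure.pi_singleton]
        gcongr with k
        rw [awayLaw_singleton]
        simp only [hφ]
        split_ifs <;> simp_all
    _ = ∑ s : Fin n → X × Bool,
          (∑ i : X, (A n s : Measure (pointClass X)) {pointHyp i}) * ∏ k, φ (s k) := by
        rw [Finset.sum_comm]
        simp_rw [Finset.sum_mul]
    _ ≤ ∑ s : Fin n → X × Bool, 1 * ∏ k, φ (s k) := by
        gcongr with s
        exact hone s
    _ = (∑ p, φ p) ^ n := by simp_rw [one_mul, Fintype.sum_pow]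
    _ = _ := by simp [hφ, Fintype.sum_prod_type]

/-- If the class is large compared with `exp K`, then some `awayLaw i` has expected risk at least
`1 / (2 (card X - 1))` at sample size `K (card X - 1)`, for any proper learner whatsoever. -/
lemma exists_le_lintegral_risk_awayLaw (A : ProperLearner (pointClass X)) (K : ℕ)
    (hK : 2 * Real.exp K ≤ Fintype.card X) :
    ∃ i : X, ENNReal.ofReal (K / 2) ≤
      ((Fintype.card X - 1) * K : ℕ) *
        ∫⁻ s, ∫⁻ h, risk (awayLaw i) h ∂(A ((Fintype.card X - 1) * K) s : Measure (pointClass X))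
          ∂(Measure.pi fun _ => awayLaw i) := by
  have hcard : 1 < Fintype.card X := Fintype.one_lt_card
  obtain ⟨M, hM⟩ : ∃ M, Fintype.card X = M + 1 := ⟨Fintype.card X - 1, by omega⟩
  have hM0 : 0 < M := by omega
  have hMr : (0 : ℝ) < M := by exact_mod_cast hM0
  set n := (Fintype.card X - 1) * K with hn
  have hn' : n = M * K := by rw [hn, hM, Nat.add_sub_cancel]
  set p : X → ℝ≥0∞ := fun i => ∫⁻ s, (A n s : Measure (pointClass X)) {pointHyp i}
        ∂(Measure.pi fun _ : Fin n => awayLaw i) with hp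
  have hsum : ∑ i, p i ≤ ENNReal.ofReal (Real.exp K) := by
    refine (sum_lintegral_pointHyp_le A n).trans ?_
    have h1 : (Fintype.card X * ((Fintype.card X - 1 : ℕ) : ℝ≥0∞)⁻¹)
        = ENNReal.ofReal ((M + 1) / M) := by
      rw [hM, Nat.add_sub_cancel, ENNReal.ofReal_div_of_pos hMr, ENNReal.ofReal_natCast,
        div_eq_mul_inv]
      congr 1
      rw [← ENNReal.ofReal_natCast]
      push_cast
      rfl
    rw [h1, ← ENNReal.ofReal_pow (by positivity)]
    refine ENNReal.ofReal_le_ofReal ?_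
    calc ((M + 1 : ℝ) / M) ^ n ≤ Real.exp (1 / M) ^ n := by
          gcongr
          rw [add_div, div_self hMr.ne', add_comm]
          exact Real.add_one_le_exp _
      _ = Real.exp K := by
          rw [← Real.exp_nat_mul, hn']
          push_cast
          congr 1
          field_simp
  obtain ⟨i, hi⟩ : ∃ i, p i ≤ ENNReal.ofReal (1 / 2) := by
    by_contra! hlt
    have h2 := ENNReal.sum_lt_sum_of_nonempty Finset.univ_nonempty fun i _ => hlt i
    refine absurd (h2.trans_le hsum) (not_lt.2 ?_)
    rw [Finset.sum_const, Finset.card_univ, nsmul_eq_mul, ← ENNReal.ofReal_natCast,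
      ← ENNReal.ofReal_mul (Nat.cast_nonneg _)]
    exact ENNReal.ofReal_le_ofReal (by linarith)
  refine ⟨i, ?_⟩
  set R := ∫⁻ s, ∫⁻ h, risk (awayLaw i) h ∂(A n s : Measure (pointClass X))
          ∂(Measure.pi fun _ : Fin n => awayLaw i) with hR
  have hmain : (M : ℝ≥0∞)⁻¹ ≤ R + (M : ℝ≥0∞)⁻¹ * p i := by
    have hMc : (Fintype.card X - 1 : ℕ) = M := by omega
    calc (M : ℝ≥0∞)⁻¹
        = ∫⁻ s, ∫⁻ _, (M : ℝ≥0∞)⁻¹ ∂(A n s : Measure (pointClass X))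
          ∂(Measure.pi fun _ : Fin n => awayLaw i) := by simp
      _ ≤ ∫⁻ s, ∫⁻ h, (risk (awayLaw i) h
            + (M : ℝ≥0∞)⁻¹ * ({pointHyp i} : Set (pointClass X)).indicator 1 h)
            ∂(A n s : Measure (pointClass X)) ∂(Measure.pi fun _ : Fin n => awayLaw i) := by
          refine lintegral_mono fun s => lintegral_mono fun h => ?_
          have := inv_le_risk_awayLaw_add i h
          rwa [hMc] at this
      _ = R + (M : ℝ≥0∞)⁻¹ * p i := by
          have hind : Measurable
              (({pointHyp i} : Set (pointClass X)).indicator (1 : pointClass X → ℝ≥0∞)) :=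
            measurable_one.indicator (measurableSet_singleton _)
          simp_rw [lintegral_add_right _ (hind.const_mul _), lintegral_const_mul _ hind,
            lintegral_indicator_one (measurableSet_singleton (pointHyp i))]
          rw [lintegral_add_right _ (measurable_of_countable _),
            lintegral_const_mul _ (measurable_of_countable _)]
  have hnM : (n : ℝ≥0∞) * (M : ℝ≥0∞)⁻¹ = K := by
    rw [hn', Nat.cast_mul, mul_comm (M : ℝ≥0∞), mul_assoc,
      ENNReal.mul_inv_cancel (by exact_mod_cast hM0.ne') (ENNReal.natCast_ne_top M), mul_one]
  have h3 : ENNReal.ofReal (K / 2) + ENNReal.ofReal (K / 2)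
      ≤ n * R + ENNReal.ofReal (K / 2) := by
    calc ENNReal.ofReal (K / 2) + ENNReal.ofReal (K / 2)
        = n * (M : ℝ≥0∞)⁻¹ := by
          rw [← ENNReal.ofReal_add (by positivity) (by positivity), hnM, add_halves,
            ENNReal.ofReal_natCast]
      _ ≤ n * (R + (M : ℝ≥0∞)⁻¹ * p i) := by gcongr
      _ = n * R + K * p i := by rw [mul_add, ← mul_assoc, hnM]
      _ ≤ n * R + K * ENNReal.ofReal (1 / 2) := by gcongr
      _ = n * R + ENNReal.ofReal (K / 2) := by
          rw [← ENNReal.ofReal_natCast K, ← ENNReal.ofReal_mul (Nat.cast_nonneg _)]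
          simp [div_eq_mul_inv]
  exact (ENNReal.add_le_add_iff_right ENNReal.ofReal_ne_top).1 h3

end PointClass

/-! ### The contradiction -/

/-- For all `F` and `c`, some class of indicators of points, which has VC dimension `1`, has no
proper learner with conditional mutual information at most `F` and expected empirical risk at most
`c / n` on realizable samples. -/
lemma exists_pointClass_forall_properLearner (F c : ℝ) :
    ∃ N : ℕ, 1 < N ∧ ∀ A : ProperLearner (pointClass (ULift.{u} (Fin N))),
      ¬ ∀ n : ℕ, 1 ≤ n →
        (∀ D : Measure (ULift.{u} (Fin N) × Bool), IsProbabilityMeasure D →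
          RealizableDist (pointClass (ULift.{u} (Fin N))) D → cmi A n D ≤ ENNReal.ofReal F) ∧
        (∀ s : Fin n → ULift.{u} (Fin N) × Bool, RealizableSample (pointClass _) s →
          n * expectedEmpRisk A s ≤ c) := by
  have hlog : 0 < Real.log (3 / 2) := Real.log_pos (by norm_num)
  -- The risk bound below reads `log (3/2) * (K / 2) ≤ F + log 2 * c`; this `K` violates it.
  obtain ⟨K, hK⟩ := exists_nat_gt ((|F| + Real.log 2 * |c|) * 2 / Real.log (3 / 2))
  have hK0 : 0 < K := by
    have : (0 : ℝ) < K := lt_of_le_of_lt (by positivity) hK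
    exact_mod_cast this
  obtain ⟨N, hN⟩ := exists_nat_ge (2 * Real.exp K)
  have hN1 : 1 < N := by
    have : (1 : ℝ) < N := by linarith [Real.one_le_exp (Nat.cast_nonneg (α := ℝ) K)]
    exact_mod_cast this
  refine ⟨N, hN1, fun A hA => ?_⟩
  have : Nontrivial (ULift.{u} (Fin N)) :=
    Fintype.one_lt_card_iff_nontrivial.1 (by simpa using hN1)
  obtain ⟨i, hi⟩ := exists_le_lintegral_risk_awayLaw A K (by simpa using hN)
  set n := (Fintype.card (ULift.{u} (Fin N)) - 1) * K with hn
  have hn1 : 1 ≤ n := by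
    have : 0 < Fintype.card (ULift.{u} (Fin N)) - 1 := by
      have := Fintype.one_lt_card (α := ULift.{u} (Fin N)); omega
    exact Nat.mul_pos this hK0
  obtain ⟨hcmi, hemp⟩ := hA n hn1
  have herr : ∫⁻ s, ∫⁻ h, errorCount s (h : ULift.{u} (Fin N) → Bool)
      ∂(A n s : Measure (pointClass (ULift.{u} (Fin N)))) ∂(Measure.pi fun _ => awayLaw i)
      ≤ ENNReal.ofReal c := by
    calc _ ≤ ∫⁻ _, ENNReal.ofReal c ∂(Measure.pi fun _ : Fin n => awayLaw i) := by
          refine lintegral_mono_ae ?_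
          filter_upwards [(realizableDist_awayLaw i).ae_realizableSample n] with s hs
          rw [lintegral_errorCount_eq_ofReal A (by omega)]
          exact ENNReal.ofReal_le_ofReal (hemp s hs)
      _ = _ := by simp
  have h1 : ENNReal.ofReal (Real.log (3 / 2) * (K / 2))
      ≤ ENNReal.ofReal (|F| + Real.log 2 * |c|) := by
    rw [ENNReal.ofReal_mul hlog.le, ENNReal.ofReal_add (abs_nonneg _) (by positivity),
      ENNReal.ofReal_mul (by positivity)]
    calc _ ≤ _ := by gcongr
      _ ≤ _ := mul_lintegral_risk_le_cmi_add A n (awayLaw i)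
      _ ≤ _ := by
        gcongr
        · exact (hcmi _ inferInstance (realizableDist_awayLaw i)).trans
            (ENNReal.ofReal_le_ofReal (le_abs_self F))
        · exact herr.trans (ENNReal.ofReal_le_ofReal (le_abs_self c))
  rw [ENNReal.ofReal_le_ofReal_iff (by positivity)] at h1
  rw [div_lt_iff₀ hlog] at hK
  linarith

end ProperCMI

open ProperCMI
theorem mainTheorem3 :
    (¬ ∃ (f : ℕ → ℝ) (c : ℝ), 0 ≤ c ∧
      ∀ (d : ℕ) (X : Type u) [MeasurableSpace X] (H : Set (X → Bool)),
        (∀ h ∈ H, Measurable h) → HasVCDim H d →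
        ∃ A : ProperLearner H, ∀ n : ℕ, 1 ≤ n → d ≤ n →
          (∀ D : Measure (X × Bool), IsProbabilityMeasure D →
            (cmi A n D : EReal) ≤ (f d : EReal)) ∧
          (∀ s : Fin n → X × Bool, RealizableSample H s →
            expectedEmpRisk A s ≤ c * d / n)) ∧
    (¬ ∃ (f : ℕ → ℝ) (c : ℝ), 0 ≤ c ∧
      ∀ (d : ℕ) (X : Type u) [MeasurableSpace X] (H : Set (X → Bool)),
        (∀ h ∈ H, Measurable h) → HasVCDim H d →
        ∃ A : ProperLearner H, ∀ n : ℕ, 1 ≤ n → d ≤ n →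
          (∀ D : Measure (X × Bool), IsProbabilityMeasure D → RealizableDist H D →
            (cmi A n D : EReal) ≤ (f d : EReal)) ∧
          (∀ s : Fin n → X × Bool, RealizableSample H s →
            expectedEmpRisk A s ≤ c * d / n)) := by
  rw [← not_or]
  intro hor
  -- The statement with all distributions is the stronger one.
  have hreal := hor.elim
    (fun ⟨f, c, hc, h⟩ => ⟨f, c, hc, fun d X _ H hm hd =>
      let ⟨A, hA⟩ := h d X H hm hd
      ⟨A, fun n hn hdn => ⟨fun D hD _ => (hA n hn hdn).1 D hD, (hA n hn hdn).2⟩⟩⟩) id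
  obtain ⟨f, c, -, h⟩ := hreal
  obtain ⟨N, hN, hno⟩ := exists_pointClass_forall_properLearner.{u} (f 1) c
  have : Nontrivial (ULift.{u} (Fin N)) :=
    Fintype.one_lt_card_iff_nontrivial.1 (by simpa using hN)
  obtain ⟨A, hA⟩ := h 1 (ULift.{u} (Fin N)) (pointClass _) (fun _ _ => measurable_of_countable _)
    hasVCDim_pointClass
  refine hno A fun n hn => ⟨fun D hD hDr => ?_, fun s hs => ?_⟩
  · rw [← EReal.coe_ennreal_le_coe_ennreal_iff, EReal.coe_ennreal_ofReal]
    exact ((hA n hn hn).1 D hD hDr).trans (by exact_mod_cast le_max_left _ _)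
  · have h1 := (hA n hn hn).2 s hs
    have hn0 : (0 : ℝ) < n := by exact_mod_cast hn
    rw [le_div_iff₀ hn0] at h1
    simpa [mul_comm] using h1
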